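/- Let $n$ and $k$ be positive integers with $k\ge 4$, and let $c:E(K_{2kn})\to\{1,\dots,k\}$ be an arbitrary (not necessarily proper) coloring of the edges of the complete graph $K_{2kn}$ on $2kn$ vertices. For a perfect matching $M$ of $K_{2kn}$ and $i\in\{1,\dots,k\}$, let $m_i(M)=|c^{-1}(i)\cap M|$ be the number of edges of $M$ of color $i$, and put $$v(M)=\big(m_1(M)-n,\dots,m_k(M)-n\big)\in\mathbb{R}^k,\qquad f(M)=\sum_{i=1}^k|m_i(M)-n|.$$ If the origin of $\mathbb{R}^k$ lies in the convex hull of $\{v(M): M \text{ a perfect matching of } K_{2kn}\}$, then there is a perfect matching $M$ of $K_{2kn}$ with $$f(M)\le 13\,k^{11/4}\,n^{3/4}\sqrt{\ln(2k)}.$$ -/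

import Mathlib

/-- The number `m_i(M)` of edges of color `i` in the subgraph `M` of a complete graph
whose edges are colored by `c`. -/
noncomputable def colorCount {V : Type} {k : ℕ} (c : SimpleGraph.TopEdgeLabeling V (Fin k))
    (M : (⊤ : SimpleGraph V).Subgraph) (i : Fin k) : ℕ :=
  {e : (⊤ : SimpleGraph V).edgeSet | (e : Sym2 V) ∈ M.edgeSet ∧ c e = i}.ncard

/-- The vector `v(M) = (m_1(M) - n, …, m_k(M) - n)` in `ℝ^k`. -/
noncomputable def deviationVector {k : ℕ} (n : ℕ)
    (c : SimpleGraph.TopEdgeLabeling (Fin (2 * k * n)) (Fin k))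
    (M : (⊤ : SimpleGraph (Fin (2 * k * n))).Subgraph) : Fin k → ℝ :=
  fun i => (colorCount c M i : ℝ) - (n : ℝ)

/-- The total deviation `f(M) = ∑ i, |m_i(M) - n|`. -/
noncomputable def totalDeviation {k : ℕ} (n : ℕ)
    (c : SimpleGraph.TopEdgeLabeling (Fin (2 * k * n)) (Fin k))
    (M : (⊤ : SimpleGraph (Fin (2 * k * n))).Subgraph) : ℝ :=
  ∑ i : Fin k, |(colorCount c M i : ℝ) - (n : ℝ)|

open Finset

/-- The partner map of a perfect matching of a complete graph: an involution without fixed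
points. -/
def IsPartnerMap {V : Type} (σ : V → V) : Prop :=
  ∀ v, σ (σ v) = v ∧ σ v ≠ v

theorem even_card_of_involution {V : Type} [DecidableEq V] (U : Finset V) (σ : V → V)
    (h : ∀ v ∈ U, σ v ∈ U ∧ σ v ≠ v ∧ σ (σ v) = v) : Even #U := by
  have h0 : ∑ v ∈ U, (1 : ZMod 2) = 0 :=
    Finset.sum_involution (fun v _ => σ v) (fun _ _ => by decide)
      (fun v hv _ => (h v hv).2.1) (fun v hv => (h v hv).1) (fun v hv => (h v hv).2.2)
  rw [even_iff_two_dvd, ← ZMod.natCast_eq_zero_iff]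
  simpa using h0

theorem exists_involution_of_even {V : Type} [DecidableEq V] (p : ℕ) :
    ∀ U : Finset V, #U = 2 * p →
      ∃ κ : V → V, ∀ v ∈ U, κ v ∈ U ∧ κ v ≠ v ∧ κ (κ v) = v := by
  induction p with
  | zero =>
    intro U hU
    refine ⟨id, fun v hv => ?_⟩
    simp_all
  | succ p ih =>
    intro U hU
    obtain ⟨a, ha, b, hb, hab⟩ := Finset.one_lt_card.mp (show 1 < #U by omega)
    obtain ⟨κ, hκ⟩ := ih ((U.erase a).erase b) (by
      rw [card_erase_of_mem (by simp [hb, hab.symm]), card_erase_of_mem ha]; omega)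
    refine ⟨fun v => if v = a then b else if v = b then a else κ v, fun v hv => ?_⟩
    by_cases h1 : v = a
    · subst h1; simp [hb, hab.symm]
    by_cases h2 : v = b
    · subst h2; simp [ha, hab, hab.symm]
    obtain ⟨h3, h4, h5⟩ := hκ v (by simp [h1, h2, hv])
    simp only [mem_erase] at h3
    simp [h1, h2, h3, h4, h5]

/-- Given two perfect matchings with partner maps `σ` and `τ`, the edges of `σ` can be ordered so
that every initial segment is left by at most two edges of `τ`. This is the state of the
construction after `p` steps. -/
theorem exists_partial_sweep {V : Type} [Fintype V] [DecidableEq V] {σ τ : V → V}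
    (hσ : IsPartnerMap σ) (hτ : IsPartnerMap τ) {m : ℕ} (hV : Fintype.card V = 2 * m) (p : ℕ)
    (hp : p ≤ m) :
    ∃ t : V → ℕ, (∀ v, t (σ v) = t v) ∧ (∀ v, t v ≤ p) ∧
      (∀ q < p, #{v | t v = q} = 2) ∧
      (∀ q ≤ p, #{v | t v < q ∧ q ≤ t (τ v)} ≤ 2) := by
  induction p with
  | zero => exact ⟨fun _ => 0, by simp, by simp, by simp, by simp⟩
  | succ p ih =>
    obtain ⟨t, h1, h2, h3, h4⟩ := ih (by omega)
    have hcard : #{v | t v < p} = 2 * p := by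
      rw [card_eq_sum_card_fiberwise (t := range p) (f := t) (by intro v; simp)]
      rw [sum_congr rfl (g := fun _ => 2)]
      · simp [mul_comm]
      · intro q hq
        rw [filter_filter, ← h3 q (mem_range.mp hq)]
        congr 1
        ext v
        have := mem_range.mp hq
        simp; omega
    obtain ⟨a, ha, hab⟩ : ∃ a, t a = p ∧
        ((∃ b, t b < p ∧ τ b = a) ∨ ∀ b, t b < p → t (τ b) < p) := by
      by_cases hb : ∃ b, t b < p ∧ p ≤ t (τ b)
      · obtain ⟨b, hb1, hb2⟩ := hb
        exact ⟨τ b, le_antisymm (h2 _) hb2, Or.inl ⟨b, hb1, rfl⟩⟩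
      · push Not at hb
        have : ∃ a, ¬ t a < p := by
          by_contra! hall
          rw [filter_true_of_mem (by simpa using hall), card_univ] at hcard
          omega
        obtain ⟨a, ha⟩ := this
        exact ⟨a, le_antisymm (h2 _) (not_lt.mp ha), Or.inr hb⟩
    have hσσ := fun v => (hσ v).1
    have hττ := fun v => (hτ v).1
    let t' : V → ℕ := fun v => if t v = p ∧ v ≠ a ∧ v ≠ σ a then p + 1 else t v
    have ht' : ∀ v, t' v = if t v = p ∧ v ≠ a ∧ v ≠ σ a then p + 1 else t v := fun _ => rfl
    clear_value t'
    have hlt : ∀ q ≤ p, ∀ v, t' v < q ↔ t v < q := by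
      intro q hq v
      rw [ht']; split_ifs <;> omega
    refine ⟨t', fun v => ?_, fun v => ?_, fun q hq => ?_, fun q hq => ?_⟩
    · have e1 : σ v = a ↔ v = σ a :=
        ⟨fun h => by rw [← h, hσσ], fun h => by rw [h, hσσ]⟩
      have e2 : σ v = σ a ↔ v = a :=
        ⟨fun h => by rw [← hσσ v, h, hσσ], fun h => by rw [h]⟩
      rw [ht', ht', h1]
      simp only [ne_eq, e1, e2]
      congr 1
      simp only [eq_iff_iff]; tauto
    · have := h2 v
      rw [ht']; split_ifs <;> omega
    · rcases Nat.lt_succ_iff_lt_or_eq.mp hq with hq | rfl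
      · rw [← h3 q hq]
        congr 1
        ext v
        have h5 := hlt q hq.le v
        have h6 := hlt (q + 1) hq v
        simp; omega
      · rw [show ({v | t' v = q} : Finset V) = {a, σ a} by
          ext v
          simp only [mem_filter, mem_univ, true_and, mem_insert, mem_singleton, ht']
          constructor
          · intro h
            by_contra hv
            rw [not_or] at hv
            split_ifs at h with h5
            · omega
            · exact h5 ⟨h, hv⟩
          · rintro (rfl | rfl)
            · simp [ha]
            · simp [h1, ha]]
        exact card_pair (hσ a).2.symm
    · rcases Nat.lt_succ_iff_lt_or_eq.mp (Nat.lt_succ_of_le hq) with hq | rfl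
      · have hq : q ≤ p := by omega
        refine le_trans (card_le_card ?_) (h4 q hq)
        intro v
        have h5 := hlt q hq v
        have h6 := hlt q hq (τ v)
        simp; omega
      · have hle : ∀ v, t' v < p + 1 → t v < p ∨ v = a ∨ v = σ a := by
          intro v hv
          have := h2 v
          by_contra! hcon
          rw [ht', if_pos ⟨by omega, hcon.2⟩] at hv
          omega
        have hge : ∀ v, p + 1 ≤ t' v → t v = p ∧ v ≠ a ∧ v ≠ σ a := by
          intro v hv
          by_contra hcon
          rw [ht', if_neg hcon] at hv
          have := h2 v
          omega
        rcases hab with ⟨b, hb1, hb2⟩ | hno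
        · have hbS : b ∈ ({v | t v < p ∧ p ≤ t (τ v)} : Finset V) := by
            simp [hb1, hb2, ha]
          calc #{v | t' v < p + 1 ∧ p + 1 ≤ t' (τ v)}
              ≤ #(insert (σ a) (({v | t v < p ∧ p ≤ t (τ v)} : Finset V).erase b)) := by
                apply card_le_card
                intro v
                simp only [mem_filter, mem_univ, true_and, mem_insert, mem_erase]
                rintro ⟨hv1, hv2⟩
                obtain ⟨h6, h7, -⟩ := hge _ hv2
                rcases hle v hv1 with h | rfl | h
                · exact Or.inr ⟨fun hvb => h7 (by rw [hvb, hb2]), h, h6.ge⟩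
                · rw [← hb2, hττ] at h6; omega
                · exact Or.inl h
            _ ≤ 2 := by
                refine (card_insert_le _ _).trans ?_
                rw [card_erase_of_mem hbS]
                have := h4 p le_rfl
                omega
        · calc #{v | t' v < p + 1 ∧ p + 1 ≤ t' (τ v)} ≤ #({a, σ a} : Finset V) := by
                apply card_le_card
                intro v
                simp only [mem_filter, mem_univ, true_and, mem_insert, mem_singleton]
                rintro ⟨hv1, hv2⟩
                obtain ⟨h6, -⟩ := hge _ hv2
                rcases hle v hv1 with h | h
                · have := hno v h; omega
                · exact h
            _ ≤ 2 := card_le_two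

theorem exists_sweep {V : Type} [Fintype V] [DecidableEq V] {σ τ : V → V}
    (hσ : IsPartnerMap σ) (hτ : IsPartnerMap τ) {m : ℕ} (hV : Fintype.card V = 2 * m) :
    ∃ t : V → ℕ, (∀ v, t (σ v) = t v) ∧ (∀ v, t v ≤ m) ∧
      (∀ q, #{v | t v = q} ≤ 2) ∧ (∀ q, #{v | t v < q ∧ q ≤ t (τ v)} ≤ 2) := by
  obtain ⟨t, h1, h2, h3, h4⟩ := exists_partial_sweep hσ hτ hV m le_rfl
  have hcard : #{v | t v < m} = 2 * m := by
    rw [card_eq_sum_card_fiberwise (t := range m) (f := t) (by intro v; simp)]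
    rw [sum_congr rfl (g := fun _ => 2)]
    · simp [mul_comm]
    · intro q hq
      rw [filter_filter, ← h3 q (mem_range.mp hq)]
      congr 1
      ext v
      have := mem_range.mp hq
      simp; omega
  have hlt : ∀ v, t v < m := by
    have := (card_eq_iff_eq_univ _).mp (hcard.trans hV.symm)
    intro v
    simpa using this.ge (mem_univ v)
  refine ⟨t, h1, h2, fun q => ?_, fun q => ?_⟩
  · by_cases hq : q < m
    · exact (h3 q hq).le
    · rw [filter_false_of_mem]
      · simp
      · intro v _; have := hlt v; omega
  · by_cases hq : q ≤ m
    · exact h4 q hq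
    · rw [filter_false_of_mem]
      · simp
      · intro v _; have := hlt (τ v); omega

/-- Derandomized second moment bound: rounding each coefficient `l` to `0` or `1`. -/
theorem exists_rounding {ι : Type} [Fintype ι] (W : ℕ → ι → ℝ) {l : ℝ} (hl0 : 0 ≤ l) (hl1 : l ≤ 1)
    (r : ℕ) :
    ∃ x : ℕ → Bool, ∑ i, (∑ j ∈ range r, ((if x j then 1 else 0) - l) * W j i) ^ 2 ≤
      l * (1 - l) * ∑ j ∈ range r, ∑ i, W j i ^ 2 := by
  induction r with
  | zero => exact ⟨fun _ => true, by simp⟩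
  | succ r ih =>
    obtain ⟨x, hx⟩ := ih
    set u : ι → ℝ := fun i => ∑ j ∈ range r, ((if x j then 1 else 0) - l) * W j i with hu
    have key : ∀ b : Bool,
        ∑ i, (∑ j ∈ range (r + 1), ((if Function.update x r b j then 1 else 0) - l) * W j i) ^ 2 =
          ∑ i, u i ^ 2 + 2 * ((if b then 1 else 0) - l) * ∑ i, u i * W r i +
            ((if b then 1 else 0) - l) ^ 2 * ∑ i, W r i ^ 2 := by
      intro b
      rw [mul_sum, mul_sum, ← sum_add_distrib, ← sum_add_distrib]
      refine sum_congr rfl fun i _ => ?_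
      rw [sum_range_succ, Function.update_self]
      rw [sum_congr rfl (g := fun j => ((if x j then 1 else 0) - l) * W j i)]
      · simp only [hu]; ring
      · intro j hj
        rw [Function.update_of_ne (mem_range.mp hj).ne]
    rw [sum_range_succ, mul_add]
    generalize ∑ i, u i * W r i = P at key
    generalize ∑ i, W r i ^ 2 = Q at key ⊢
    by_cases hA : 2 * P + (1 - 2 * l) * Q ≤ 0
    · refine ⟨Function.update x r true, ?_⟩
      have := mul_nonpos_of_nonneg_of_nonpos (sub_nonneg.mpr hl1) hA
      rw [key]
      simp only [if_true]
      linarith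
    · refine ⟨Function.update x r false, ?_⟩
      have := mul_nonneg hl0 (not_le.mp hA).le
      rw [key]
      simp only [Bool.false_eq_true, if_false]
      linarith

/-- The number of vertices whose partner edge has color `i`; twice the number of edges of
color `i`. -/
noncomputable def incidenceCount {V ι : Type} [Fintype V] [DecidableEq ι] (d : V → V → ι)
    (σ : V → V) (i : ι) : ℝ :=
  ∑ v, if d v (σ v) = i then 1 else 0

theorem sum_abs_indicator_sub_le {ι : Type} [Fintype ι] [DecidableEq ι] (a b : ι) :
    ∑ i, |(if a = i then (1 : ℝ) else 0) - (if b = i then 1 else 0)| ≤ 2 := by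
  calc ∑ i, |(if a = i then (1 : ℝ) else 0) - (if b = i then 1 else 0)|
      ≤ ∑ i, ((if a = i then (1 : ℝ) else 0) + (if b = i then 1 else 0)) := by
        gcongr with i
        split_ifs <;> norm_num
    _ = 2 := by rw [sum_add_distrib]; simp; norm_num

/-- Switching between two partner maps along a set `S` closed under the first one, repairing the
vertices that lose their partner arbitrarily. -/
theorem exists_switch {V : Type} [Fintype V] [DecidableEq V] {σ τ : V → V}
    (hσ : IsPartnerMap σ) (hτ : IsPartnerMap τ) (S : V → Prop) [DecidablePred S]
    (hS : ∀ v, S (σ v) ↔ S v) :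
    ∃ ρ : V → V, IsPartnerMap ρ ∧
      ∀ v, ¬ (¬ S v ∧ S (τ v)) → ρ v = if S v then σ v else τ v := by
  set U : Finset V := {v | ¬ S v ∧ S (τ v)} with hU
  have hττ := fun v => (hτ v).1
  have hV : Even #(univ : Finset V) :=
    even_card_of_involution univ σ fun v _ => ⟨mem_univ _, (hσ v).2, (hσ v).1⟩
  have hS1 : Even #({v | S v} : Finset V) :=
    even_card_of_involution _ σ fun v hv => ⟨by simpa [hS] using hv, (hσ v).2, (hσ v).1⟩
  have hS2 : Even #({v | ¬ S v ∧ ¬ S (τ v)} : Finset V) :=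
    even_card_of_involution _ τ fun v hv =>
      ⟨by simpa [hττ, and_comm] using hv, (hτ v).2, (hτ v).1⟩
  have hsum : #(univ : Finset V) =
      #({v | S v} : Finset V) + (#U + #({v | ¬ S v ∧ ¬ S (τ v)} : Finset V)) := by
    rw [← card_filter_add_card_filter_not (s := univ) S,
      ← card_filter_add_card_filter_not (s := ({v | ¬ S v} : Finset V)) (fun v => S (τ v)),
      filter_filter, filter_filter]
  obtain ⟨p, hp⟩ : Even #U := by
    rw [hsum] at hV
    exact (Nat.even_add.mp ((Nat.even_add.mp hV).mp hS1)).mpr hS2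
  obtain ⟨κ, hκ⟩ := exists_involution_of_even p U (by omega)
  simp only [hU, mem_filter, mem_univ, true_and] at hκ
  refine ⟨fun v => if S v then σ v else if S (τ v) then κ v else τ v, fun v => ?_, fun v hv => ?_⟩
  · by_cases h1 : S v
    · have := hσ v
      simp [h1, hS, this]
    by_cases h2 : S (τ v)
    · have := hκ v ⟨h1, h2⟩
      simp [h1, h2, this]
    · have := hτ v
      simp [h1, h2, this]
  · by_cases h1 : S v
    · simp [h1]
    · have h2 : ¬ S (τ v) := fun h => hv ⟨h1, h⟩
      simp [h1, h2]

theorem card_block_boundary_le {V : Type} [Fintype V] [DecidableEq V] {τ : V → V}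
    (hτ : IsPartnerMap τ) {t : V → ℕ} {s r : ℕ} (hs : 0 < s) (htr : ∀ v, t v / s < r)
    (ht : ∀ q, #{v | t v < q ∧ q ≤ t (τ v)} ≤ 2) :
    #{v | t v / s ≠ t (τ v) / s} ≤ 4 * r := by
  have hττ := fun v => (hτ v).1
  have hsub : ({v | t v / s ≠ t (τ v) / s} : Finset V) ⊆ (range r).biUnion fun j =>
      ({v | t v < j * s ∧ j * s ≤ t (τ v)} : Finset V) ∪
        ({v | t v < j * s ∧ j * s ≤ t (τ v)} : Finset V).image τ := by
    intro v hv
    simp only [mem_filter, mem_univ, true_and] at hv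
    simp only [mem_biUnion, mem_range, mem_union, mem_filter, mem_univ, true_and, mem_image]
    rcases lt_or_gt_of_ne hv with h | h
    · exact ⟨t (τ v) / s, htr _, Or.inl ⟨(Nat.div_lt_iff_lt_mul hs).mp h, Nat.div_mul_le_self _ _⟩⟩
    · refine ⟨t v / s, htr _, Or.inr ⟨τ v, ⟨(Nat.div_lt_iff_lt_mul hs).mp h, ?_⟩, hττ v⟩⟩
      rw [hττ]
      exact Nat.div_mul_le_self _ _
  refine (card_le_card hsub).trans (card_biUnion_le.trans ?_)
  calc ∑ j ∈ range r, _ ≤ ∑ j ∈ range r, 4 := by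
        gcongr with j
        refine (card_union_le _ _).trans ?_
        have h1 := ht (j * s)
        have h2 := card_image_le (s := ({v | t v < j * s ∧ j * s ≤ t (τ v)} : Finset V)) (f := τ)
        omega
    _ = 4 * r := by simp [mul_comm]

/-- Any convex combination of the color statistics of two perfect matchings is approximated by
the color statistics of a perfect matching. -/
theorem exists_merge {V ι : Type} [Fintype V] [DecidableEq V] [Fintype ι] [DecidableEq ι]
    {σ τ : V → V} (hσ : IsPartnerMap σ) (hτ : IsPartnerMap τ) {m : ℕ}
    (hV : Fintype.card V = 2 * m) (d : V → V → ι) {l : ℝ} (hl0 : 0 ≤ l) (hl1 : l ≤ 1)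
    {s : ℕ} (hs : 0 < s) :
    ∃ ρ : V → V, IsPartnerMap ρ ∧
      ∑ i, |incidenceCount d ρ i - (l * incidenceCount d σ i + (1 - l) * incidenceCount d τ i)| ≤
        2 * s * √(Fintype.card ι * (m / s + 1 : ℕ)) + 8 * (m / s + 1 : ℕ) := by
  obtain ⟨t, h1, h2, h3, h4⟩ := exists_sweep hσ hτ hV
  set r := m / s + 1 with hr
  have htr : ∀ v, t v / s < r := fun v => Nat.lt_succ_of_le (Nat.div_le_div_right (h2 v))
  let g : (V → V) → V → ι → ℝ := fun π v i => if d v (π v) = i then 1 else 0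
  let W : ℕ → ι → ℝ := fun j i => ∑ v with t v / s = j, (g σ v i - g τ v i)
  have hblock : ∀ j, #{v | t v / s = j} ≤ 2 * s := by
    intro j
    have hmaps : ∀ v ∈ ({v | t v / s = j} : Finset V), t v ∈ Ico (j * s) ((j + 1) * s) := by
      intro v hv
      simp only [mem_filter, mem_univ, true_and] at hv
      rw [mem_Ico, ← hv]
      exact ⟨Nat.div_mul_le_self _ _, by
        rw [← Nat.div_lt_iff_lt_mul hs]; exact Nat.lt_succ_self _⟩
    refine (card_le_mul_card_image_of_maps_to hmaps 2 fun q _ => ?_).trans_eq ?_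
    · exact (card_le_card (filter_subset_filter _ (subset_univ _))).trans (h3 q)
    · rw [Nat.card_Ico, add_mul, one_mul, Nat.add_sub_cancel_left]
  have hW : ∀ j, ∑ i, W j i ^ 2 ≤ 16 * (s : ℝ) ^ 2 := by
    intro j
    have hW1 : ∑ i, |W j i| ≤ 4 * s := by
      calc ∑ i, |W j i| ≤ ∑ i, ∑ v with t v / s = j, |g σ v i - g τ v i| := by
            gcongr; exact abs_sum_le_sum_abs _ _
        _ = ∑ v with t v / s = j, ∑ i, |g σ v i - g τ v i| := sum_comm
        _ ≤ ∑ v with t v / s = j, 2 := by gcongr; exact sum_abs_indicator_sub_le _ _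
        _ = #{v | t v / s = j} * 2 := by simp
        _ ≤ (2 * s : ℕ) * 2 := by gcongr; exact_mod_cast hblock j
        _ = 4 * s := by push_cast; ring
    calc ∑ i, W j i ^ 2 = ∑ i, |W j i| ^ 2 := by simp
      _ ≤ (∑ i, |W j i|) ^ 2 := sum_sq_le_sq_sum_of_nonneg fun i _ => abs_nonneg _
      _ ≤ (4 * s) ^ 2 := by gcongr
      _ = 16 * (s : ℝ) ^ 2 := by ring
  obtain ⟨x, hx⟩ := exists_rounding W hl0 hl1 r
  set D : ι → ℝ := fun i => ∑ j ∈ range r, ((if x j then 1 else 0) - l) * W j i with hD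
  have hDv : ∀ i, D i = ∑ v, ((if x (t v / s) then 1 else 0) - l) * (g σ v i - g τ v i) := by
    intro i
    rw [← sum_fiberwise_of_maps_to (s := univ) (t := range r) (g := fun v => t v / s)
      (fun v _ => mem_range.mpr (htr v))]
    refine sum_congr rfl fun j _ => ?_
    rw [mul_sum]
    refine sum_congr rfl fun v hv => ?_
    rw [(mem_filter.mp hv).2]
  have hDsum : ∑ i, |D i| ≤ 2 * s * √(Fintype.card ι * r) := by
    have hsq : (∑ i, |D i|) ^ 2 ≤ (2 * s) ^ 2 * (Fintype.card ι * r) := by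
      calc (∑ i, |D i|) ^ 2 ≤ Fintype.card ι * ∑ i, |D i| ^ 2 := sq_sum_le_card_mul_sum_sq
        _ = Fintype.card ι * ∑ i, D i ^ 2 := by simp
        _ ≤ Fintype.card ι * (1 / 4 * ∑ j ∈ range r, 16 * (s : ℝ) ^ 2) := by
            gcongr
            refine hx.trans ?_
            gcongr with j _
            · nlinarith [sq_nonneg (l - 1 / 2)]
            · exact hW j
        _ = (2 * s) ^ 2 * (Fintype.card ι * r) := by simp; ring
    calc ∑ i, |D i| ≤ √((2 * s) ^ 2 * (Fintype.card ι * r)) := Real.le_sqrt_of_sq_le hsq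
      _ = 2 * s * √(Fintype.card ι * r) := by
          rw [Real.sqrt_mul (by positivity), Real.sqrt_sq (by positivity)]
  obtain ⟨ρ, hρ, hρeq⟩ := exists_switch hσ hτ (fun v => x (t v / s) = true)
    (fun v => by simp only [h1])
  refine ⟨ρ, hρ, ?_⟩
  set e : V → ι → ℝ := fun v i => g ρ v i - if x (t v / s) then g σ v i else g τ v i with he
  have hE : ∑ i, |∑ v, e v i| ≤ 8 * r := by
    calc ∑ i, |∑ v, e v i| ≤ ∑ i, ∑ v, |e v i| := by gcongr; exact abs_sum_le_sum_abs _ _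
      _ = ∑ v, ∑ i, |e v i| := sum_comm
      _ ≤ ∑ v, if t v / s ≠ t (τ v) / s then 2 else 0 := by
          gcongr with v
          by_cases hv : ¬ x (t v / s) = true ∧ x (t (τ v) / s) = true
          · rw [if_pos (fun h : t v / s = t (τ v) / s => hv.1 (by rw [h]; exact hv.2))]
            simp only [he, if_neg hv.1]
            exact sum_abs_indicator_sub_le _ _
          · have : ∀ i, e v i = 0 := by
              intro i
              simp only [he, g, hρeq v hv]
              split_ifs <;> simp_all
            simp only [this, abs_zero, sum_const_zero]
            split_ifs <;> norm_num
      _ = (#{v | t v / s ≠ t (τ v) / s} : ℝ) * 2 := by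
          rw [← sum_filter]; simp
      _ ≤ (4 * r : ℕ) * 2 := by
          gcongr; exact_mod_cast card_block_boundary_le hτ hs htr h4
      _ = 8 * r := by push_cast; ring
  calc _ = ∑ i, |D i + ∑ v, e v i| := by
        refine sum_congr rfl fun i _ => ?_
        rw [hDv, incidenceCount, incidenceCount, incidenceCount, mul_sum, mul_sum,
          ← sum_add_distrib, ← sum_sub_distrib, ← sum_add_distrib]
        congr 1
        refine sum_congr rfl fun v _ => ?_
        simp only [he, g]
        by_cases hx : x (t v / s) = true
        · simp only [hx, if_true]; ring
        · simp only [hx, Bool.false_eq_true, if_false]; ring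
    _ ≤ ∑ i, (|D i| + |∑ v, e v i|) := by gcongr; exact abs_add_le _ _
    _ ≤ _ := by rw [sum_add_distrib]; gcongr

/-- An edge labeling as a function of ordered pairs of vertices, with an arbitrary value on the
diagonal. -/
def pairLabel {V : Type} [DecidableEq V] {k : ℕ} (c : SimpleGraph.TopEdgeLabeling V (Fin k))
    (i₀ : Fin k) (v w : V) : Fin k :=
  if h : v ≠ w then c ⟨s(v, w), by simpa using h⟩ else i₀

theorem exists_partnerMap {V : Type} {M : (⊤ : SimpleGraph V).Subgraph}
    (hM : M.IsPerfectMatching) :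
    ∃ σ : V → V, IsPartnerMap σ ∧ ∀ v w, M.Adj v w ↔ σ v = w := by
  rw [SimpleGraph.Subgraph.isPerfectMatching_iff] at hM
  choose σ hσ hσ' using hM
  have h : ∀ v w, M.Adj v w ↔ σ v = w := fun v w =>
    ⟨fun h => (hσ' v w h).symm, fun h => h ▸ hσ v⟩
  exact ⟨σ, fun v => ⟨(h _ _).mp (hσ v).symm, (hσ v).adj_sub.ne.symm⟩, h⟩

theorem exists_perfectMatching_of_partnerMap {V : Type} {σ : V → V} (hσ : IsPartnerMap σ) :
    ∃ M : (⊤ : SimpleGraph V).Subgraph, M.IsPerfectMatching ∧ ∀ v w, M.Adj v w ↔ σ v = w := by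
  refine ⟨⟨Set.univ, fun v w => σ v = w, ?_, fun _ => trivial, ⟨?_⟩⟩, ?_, fun _ _ => Iff.rfl⟩
  · rintro v w rfl
    simpa using (hσ v).2.symm
  · rintro v w rfl
    exact (hσ v).1
  · rw [SimpleGraph.Subgraph.isPerfectMatching_iff]
    exact fun v => ⟨σ v, rfl, fun w hw => Eq.symm hw⟩

theorem incidenceCount_eq_two_mul_colorCount {V : Type} [Fintype V] [DecidableEq V] {k : ℕ}
    (c : SimpleGraph.TopEdgeLabeling V (Fin k)) (i₀ : Fin k) {σ : V → V} (hσ : IsPartnerMap σ)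
    {M : (⊤ : SimpleGraph V).Subgraph} (hM : ∀ v w, M.Adj v w ↔ σ v = w) (i : Fin k) :
    incidenceCount (pairLabel c i₀) σ i = 2 * colorCount c M i := by
  classical
  let F : V → (⊤ : SimpleGraph V).edgeSet := fun v =>
    ⟨s(v, σ v), by simpa using (hσ v).2.symm⟩
  have hF : ∀ v, pairLabel c i₀ v (σ v) = c (F v) := fun v => by
    rw [pairLabel, dif_pos (hσ v).2.symm]
  have hmem : ∀ v, (F v : Sym2 V) ∈ M.edgeSet := fun v => by
    rw [SimpleGraph.Subgraph.mem_edgeSet, hM]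
  have hcard : #({v | c (F v) = i} : Finset V) =
      2 * #({e | (e : Sym2 V) ∈ M.edgeSet ∧ c e = i} : Finset (⊤ : SimpleGraph V).edgeSet) := by
    rw [card_eq_sum_card_fiberwise (f := F)
      (t := {e | (e : Sym2 V) ∈ M.edgeSet ∧ c e = i}) (fun v hv => by simp_all)]
    rw [sum_congr rfl (g := fun _ => 2)]
    · simp [mul_comm]
    · rintro ⟨e, he⟩ heM
      induction e using Sym2.ind with
      | _ a b =>
      simp only [mem_filter, mem_univ, true_and, SimpleGraph.Subgraph.mem_edgeSet, hM] at heM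
      obtain ⟨rfl, hc⟩ := heM
      rw [← card_pair (hσ a).2.symm, filter_filter]
      congr 1
      ext v
      simp only [mem_filter, mem_univ, true_and, mem_insert, mem_singleton, F, Subtype.mk.injEq,
        Sym2.eq_iff]
      constructor
      · rintro ⟨-, h | h⟩
        · exact Or.inl h.1
        · exact Or.inr h.1
      · rintro (rfl | rfl)
        · exact ⟨hc, Or.inl ⟨rfl, rfl⟩⟩
        · refine ⟨?_, Or.inr ⟨rfl, (hσ a).1⟩⟩
          rw [← hc]
          congr 2
          simp [(hσ a).1, Sym2.eq_swap]
  rw [incidenceCount, colorCount]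
  simp only [hF]
  rw [sum_boole, hcard, ← Set.ncard_coe_finset]
  simp

/-- If every convex combination of two points of `A` is within `E` of a point of `A`, then every
point of the convex hull of a finite `T ⊆ A` is within `#T * E` of a point of `A`. -/
theorem exists_near_of_mem_convexHull {k : ℕ} {A : Set (Fin k → ℝ)} {E : ℝ} (hE : 0 ≤ E)
    (hA : ∀ x ∈ A, ∀ y ∈ A, ∀ l : ℝ, 0 ≤ l → l ≤ 1 →
      ∃ z ∈ A, ∑ i, |z i - (l * x i + (1 - l) * y i)| ≤ E)
    (T : Finset (Fin k → ℝ)) :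
    (T : Set (Fin k → ℝ)) ⊆ A → ∀ p ∈ convexHull ℝ (T : Set (Fin k → ℝ)),
      ∃ z ∈ A, ∑ i, |z i - p i| ≤ #T * E := by
  classical
  induction T using Finset.induction_on with
  | empty => intro _ p hp; simp at hp
  | insert x T hx ih =>
    intro hT p hp
    rw [coe_insert] at hT hp
    have hxA : x ∈ A := hT (Set.mem_insert _ _)
    have hTA := (Set.subset_insert x (T : Set (Fin k → ℝ))).trans hT
    rcases T.eq_empty_or_nonempty with rfl | hne
    · have : p = x := by simpa using hp
      subst this
      exact ⟨p, hxA, by simpa using hE⟩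
    · rw [convexHull_insert (by simpa using hne), convexJoin_singleton_left] at hp
      simp only [Set.mem_iUnion, exists_prop] at hp
      obtain ⟨q, hq, a, b, ha, hb, hab, rfl⟩ := hp
      obtain ⟨y, hyA, hy⟩ := ih hTA q hq
      obtain ⟨z, hzA, hz⟩ := hA x hxA y hyA a ha (by linarith)
      refine ⟨z, hzA, ?_⟩
      have hb' : 1 - a = b := by linarith
      rw [hb'] at hz
      calc ∑ i, |z i - (a • x + b • q) i|
          ≤ ∑ i, (|z i - (a * x i + b * y i)| + b * |y i - q i|) := by
            gcongr with i
            rw [← abs_of_nonneg hb, ← abs_mul, abs_of_nonneg hb]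
            refine le_of_eq_of_le ?_ (abs_add_le _ _)
            simp only [Pi.add_apply, Pi.smul_apply, smul_eq_mul]
            congr 1; ring
        _ ≤ E + 1 * (#T * E) := by
            rw [sum_add_distrib, ← mul_sum]
            gcongr
            linarith
        _ = #(insert x T) * E := by
            rw [card_insert_of_notMem hx]; push_cast; ring

theorem merge_error_le {n k : ℕ} (hn : 0 < n) (hk : 4 ≤ k) :
    (2 * Nat.sqrt n * √(k * (k * n / Nat.sqrt n + 1 : ℕ)) + 8 * (k * n / Nat.sqrt n + 1 : ℕ)) / 2 ≤
      23 * k * (n : ℝ) ^ (3 / 4 : ℝ) := by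
  have hs : 0 < Nat.sqrt n := Nat.sqrt_pos.mpr hn
  have hs1 : Nat.sqrt n ^ 2 ≤ n := Nat.sqrt_le' n
  have hs2 : n < (Nat.sqrt n + 1) ^ 2 := Nat.lt_succ_sqrt' n
  generalize Nat.sqrt n = s at *
  have hr : k * n / s + 1 ≤ 5 * k * s := by
    have h1 : k * n / s ≤ 4 * k * s := by
      apply Nat.div_le_of_le_mul
      have : n ≤ 4 * s ^ 2 := by nlinarith
      calc k * n ≤ k * (4 * s ^ 2) := by gcongr
        _ = s * (4 * k * s) := by ring
    nlinarith
  have hrR : ((k * n / s + 1 : ℕ) : ℝ) ≤ 5 * k * s := by exact_mod_cast hr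
  have hsR : (1 : ℝ) ≤ s := by exact_mod_cast hs
  have hsqrt : √(k * (k * n / s + 1 : ℕ)) ≤ 3 * k * √s := by
    apply Real.sqrt_le_iff.mpr ⟨by positivity, ?_⟩
    rw [mul_pow, Real.sq_sqrt (by positivity)]
    calc (k : ℝ) * (k * n / s + 1 : ℕ) ≤ k * (5 * k * s) := by gcongr
      _ ≤ (3 * k) ^ 2 * s := by
        have : 0 ≤ (k : ℝ) ^ 2 * s := by positivity
        nlinarith
  have hroot : (s : ℝ) ≤ s * √s := le_mul_of_one_le_right (by positivity) (Real.one_le_sqrt.mpr hsR)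
  have hpow : (s : ℝ) * √s ≤ (n : ℝ) ^ (3 / 4 : ℝ) := by
    calc (s : ℝ) * √s = (s : ℝ) ^ (1 + 1 / 2 : ℝ) := by
          rw [Real.rpow_add (by positivity), Real.rpow_one, Real.sqrt_eq_rpow]
      _ = ((s : ℝ) ^ 2) ^ (3 / 4 : ℝ) := by
          rw [← Real.rpow_natCast, ← Real.rpow_mul (by positivity)]; norm_num
      _ ≤ (n : ℝ) ^ (3 / 4 : ℝ) := by
          gcongr; exact_mod_cast hs1
  calc _ ≤ (2 * s * (3 * k * √s) + 8 * (5 * k * s)) / 2 := by gcongr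
    _ = 3 * k * (s * √s) + 20 * k * s := by ring
    _ ≤ 3 * k * (s * √s) + 20 * k * (s * √s) := by gcongr
    _ = 23 * k * (s * √s) := by ring
    _ ≤ _ := by gcongr

theorem total_error_le {k : ℕ} (hk : 4 ≤ k) {N : ℝ} (hN : 0 ≤ N) :
    ((k : ℝ) + 1) * (23 * k * N) ≤
      13 * (k : ℝ) ^ (11 / 4 : ℝ) * N * √(Real.log (2 * (k : ℝ))) := by
  have hkR : (4 : ℝ) ≤ k := by exact_mod_cast hk
  have hlog : (6 / 5 : ℝ) ≤ √(Real.log (2 * (k : ℝ))) := by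
    apply Real.le_sqrt_of_sq_le
    have h1 : Real.log 8 ≤ Real.log (2 * (k : ℝ)) := Real.log_le_log (by norm_num) (by linarith)
    have h2 : Real.log 8 = 3 * Real.log 2 := by
      rw [show (8 : ℝ) = 2 ^ 3 by norm_num, Real.log_pow]; norm_num
    have := Real.log_two_gt_d9
    norm_num
    linarith
  have hpow : 2 * (k : ℝ) ^ 2 ≤ (k : ℝ) ^ (11 / 4 : ℝ) := by
    calc 2 * (k : ℝ) ^ 2 ≤ (k : ℝ) ^ (1 / 2 : ℝ) * (k : ℝ) ^ (2 : ℝ) := by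
          rw [Real.rpow_two, ← Real.sqrt_eq_rpow]
          gcongr
          exact Real.le_sqrt_of_sq_le (by linarith)
      _ = (k : ℝ) ^ (1 / 2 + 2 : ℝ) := by rw [Real.rpow_add (by positivity)]
      _ ≤ _ := Real.rpow_le_rpow_of_exponent_le (by linarith) (by norm_num)
  calc ((k : ℝ) + 1) * (23 * k * N) ≤ (5 / 4 * k) * (23 * k * N) := by
        refine mul_le_mul_of_nonneg_right ?_ (by positivity)
        linarith
    _ = 115 / 4 * (k ^ 2 * N) := by ring
    _ ≤ 156 / 5 * (k ^ 2 * N) := mul_le_mul_of_nonneg_right (by norm_num) (by positivity)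
    _ = 13 * (2 * (k : ℝ) ^ 2) * N * (6 / 5) := by ring
    _ ≤ _ := by gcongr

theorem exists_merged_deviationVector {n k : ℕ} (hn : 0 < n) (hk : 4 ≤ k)
    (c : SimpleGraph.TopEdgeLabeling (Fin (2 * k * n)) (Fin k))
    {M N : (⊤ : SimpleGraph (Fin (2 * k * n))).Subgraph}
    (hM : M.IsPerfectMatching) (hN : N.IsPerfectMatching) {l : ℝ} (hl0 : 0 ≤ l) (hl1 : l ≤ 1) :
    ∃ P : (⊤ : SimpleGraph (Fin (2 * k * n))).Subgraph, P.IsPerfectMatching ∧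
      ∑ i, |deviationVector n c P i -
        (l * deviationVector n c M i + (1 - l) * deviationVector n c N i)| ≤
          23 * k * (n : ℝ) ^ (3 / 4 : ℝ) := by
  obtain ⟨σ, hσ, hMσ⟩ := exists_partnerMap hM
  obtain ⟨τ, hτ, hNτ⟩ := exists_partnerMap hN
  let i₀ : Fin k := ⟨0, by omega⟩
  obtain ⟨ρ, hρ, hρE⟩ := exists_merge hσ hτ (m := k * n) (by simp [mul_assoc]) (pairLabel c i₀)
    hl0 hl1 (Nat.sqrt_pos.mpr hn)
  obtain ⟨P, hP, hPρ⟩ := exists_perfectMatching_of_partnerMap hρ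
  refine ⟨P, hP, ?_⟩
  rw [Fintype.card_fin] at hρE
  refine le_trans ?_ ((div_le_div_of_nonneg_right hρE zero_le_two).trans (merge_error_le hn hk))
  rw [sum_div]
  refine (sum_congr rfl fun i _ => ?_).le
  rw [incidenceCount_eq_two_mul_colorCount c i₀ hρ hPρ,
    incidenceCount_eq_two_mul_colorCount c i₀ hσ hMσ,
    incidenceCount_eq_two_mul_colorCount c i₀ hτ hNτ, eq_div_iff two_ne_zero,
    ← abs_of_pos (zero_lt_two (α := ℝ)), ← abs_mul, abs_of_pos (zero_lt_two (α := ℝ))]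
  simp only [deviationVector]
  congr 1; ring

theorem theorem3 (n k : ℕ) (hn : 0 < n) (hk : 4 ≤ k)
    (c : SimpleGraph.TopEdgeLabeling (Fin (2 * k * n)) (Fin k))
    (hc : (0 : Fin k → ℝ) ∈ convexHull ℝ
      {x : Fin k → ℝ | ∃ M : (⊤ : SimpleGraph (Fin (2 * k * n))).Subgraph,
        M.IsPerfectMatching ∧ x = deviationVector n c M}) :
    ∃ M : (⊤ : SimpleGraph (Fin (2 * k * n))).Subgraph,
      M.IsPerfectMatching ∧
        totalDeviation n c M ≤
          13 * (k : ℝ) ^ (11 / 4 : ℝ) * (n : ℝ) ^ (3 / 4 : ℝ) *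
            Real.sqrt (Real.log (2 * (k : ℝ))) := by
  rw [convexHull_eq_union] at hc
  simp only [Set.mem_iUnion, exists_prop] at hc
  obtain ⟨T, hTA, hind, h0⟩ := hc
  have hE : (0 : ℝ) ≤ 23 * k * (n : ℝ) ^ (3 / 4 : ℝ) := by positivity
  obtain ⟨z, ⟨M, hM, rfl⟩, hz⟩ := exists_near_of_mem_convexHull hE (by
    rintro _ ⟨M, hM, rfl⟩ _ ⟨N, hN, rfl⟩ l hl0 hl1
    obtain ⟨P, hP, hPE⟩ := exists_merged_deviationVector hn hk c hM hN hl0 hl1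
    exact ⟨_, ⟨P, hP, rfl⟩, hPE⟩) T hTA 0 h0
  refine ⟨M, hM, ?_⟩
  have hT : #T ≤ k + 1 := by
    have h1 := hind.card_le_finrank_succ
    have h2 := (vectorSpan ℝ (Set.range ((↑) : T → Fin k → ℝ))).finrank_le
    simp only [Fintype.card_coe, Module.finrank_fin_fun] at h1 h2
    omega
  calc totalDeviation n c M = ∑ i, |deviationVector n c M i - (0 : Fin k → ℝ) i| := by
        simp [totalDeviation, deviationVector]
    _ ≤ #T * (23 * k * (n : ℝ) ^ (3 / 4 : ℝ)) := hz
    _ ≤ ((k : ℝ) + 1) * (23 * k * (n : ℝ) ^ (3 / 4 : ℝ)) := by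
        gcongr; exact_mod_cast hT
    _ ≤ _ := total_error_le hk (by positivity)
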